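/- Let $0\le\alpha<1/2$ and $\beta>0$, let $\Omega=[0,\alpha)\cup[\alpha+\beta,1+\beta)$ and let $g=\chi_\Omega$. For $\lambda=(t,\nu)\in\mathbb{R}^2$ put $g_\lambda(x)=g(x-t)e^{2\pi i\nu x}$. Let $\Lambda\subseteq\mathbb{R}^2$ be a set such that $\{g_\lambda\}_{\lambda\in\Lambda}$ is an orthonormal basis of $L^2(\mathbb{R})$. (i) If $(0,0)\in\Lambda$, then $\Lambda$ is standard, i.e. there are $a_k\in[0,1)$, $k\in\mathbb{Z}$, such that $$\Lambda=\bigcup_{k\in\mathbb{Z}}\{k\}\times(\mathbb{Z}+a_k).$$ (ii) In general (without the normalization $(0,0)\in\Lambda$), $\Lambda$ is standard up to a translation in time: there are $s\in[0,1)$ and $a_k\in[0,1)$, $k\in\mathbb{Z}$, such that $$\Lambda=\bigcup_{k\in\mathbb{Z}}\{k+s\}\times(\mathbb{Z}+a_k).$$ -/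

import Mathlib

open MeasureTheory Set

noncomputable section

/-- The time-frequency shift `g_{(t,ν)}(x) = g(x - t) e^{2πi x ν}`. -/
def timeFrequencyShift (g : ℝ → ℂ) (p : ℝ × ℝ) : ℝ → ℂ :=
  fun x => g (x - p.1) * Complex.exp (2 * Real.pi * Complex.I * x * p.2)

/-- The Gabor system `{g_p}_{p ∈ Λ}` is an orthonormal basis of `L²(ℝ)`: there is a Hilbert
basis of `L²(ℝ; ℂ)` indexed by `Λ` whose member at `p` is the class of `g_p`. -/
def IsGaborOrthonormalBasis (g : ℝ → ℂ) (Λ : Set (ℝ × ℝ)) : Prop :=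
  ∃ b : HilbertBasis Λ ℂ (Lp ℂ 2 (volume : Measure ℝ)),
    ∀ p : Λ, (b p : ℝ → ℂ) =ᵐ[volume] timeFrequencyShift g p

/-- The union of two intervals `[0, α) ∪ [α + β, 1 + β)`. -/
def twoIntervals (α β : ℝ) : Set ℝ := Ico 0 α ∪ Ico (α + β) (1 + β)

/-- The characteristic function of a set of reals, with complex values. -/
def charFn (S : Set ℝ) : ℝ → ℂ := S.indicator (fun _ => 1)

/-- The set `⋃_{k ∈ ℤ} {k + s} × (ℤ + a_k)`. -/
def shiftedColumns (s : ℝ) (a : ℤ → ℝ) : Set (ℝ × ℝ) :=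
  ⋃ k : ℤ, {(k : ℝ) + s} ×ˢ range (fun n : ℤ => (n : ℝ) + a k)

/-- `Λ` is standard: `Λ = ⋃_{k ∈ ℤ} {k} × (ℤ + a_k)` with `a_k ∈ [0, 1)`. -/
def IsStandard (Λ : Set (ℝ × ℝ)) : Prop :=
  ∃ a : ℤ → ℝ, (∀ k, a k ∈ Ico (0 : ℝ) 1) ∧
    Λ = ⋃ k : ℤ, {(k : ℝ)} ×ˢ range (fun n : ℤ => (n : ℝ) + a k)

end

noncomputable section

open scoped ENNReal Topology Pointwise


/-- The intersection `S ∩ (S + t)`. -/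
def overlap (S : Set ℝ) (t : ℝ) : Set ℝ := S ∩ {x | x - t ∈ S}

/-- The cross-ambiguity function of `χ_S`. -/
def ambiguity (S : Set ℝ) (p : ℝ × ℝ) : ℂ :=
  ∫ x in overlap S p.1, Complex.exp (2 * Real.pi * Complex.I * x * p.2)

lemma norm_cexp_two_pi (x ν : ℝ) : ‖Complex.exp (2 * Real.pi * Complex.I * x * ν)‖ = 1 := by
  have : (2 * Real.pi * Complex.I * x * ν : ℂ) = ((2 * Real.pi * x * ν : ℝ) : ℂ) * Complex.I := by
    push_cast; ring
  rw [this, Complex.norm_exp_ofReal_mul_I]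

lemma conj_cexp_two_pi (x ν : ℝ) :
    (starRingEnd ℂ) (Complex.exp (2 * Real.pi * Complex.I * x * ν)) =
      Complex.exp (-(2 * Real.pi * Complex.I * x * ν)) := by
  rw [← Complex.exp_conj]
  congr 1
  simp [Complex.conj_ofNat]

lemma measurableSet_overlap {S : Set ℝ} (hS : MeasurableSet S) (t : ℝ) :
    MeasurableSet (overlap S t) :=
  hS.inter ((measurable_id.sub_const t) hS)

lemma memLp_charFn {S : Set ℝ} (hS : MeasurableSet S) (hS' : volume S ≠ ∞) :
    MemLp (charFn S) 2 volume :=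
  memLp_indicator_const 2 hS 1 (Or.inr hS')

lemma norm_timeFrequencyShift (g : ℝ → ℂ) (p : ℝ × ℝ) (x : ℝ) :
    ‖timeFrequencyShift g p x‖ = ‖g (x - p.1)‖ := by
  simp [timeFrequencyShift, norm_cexp_two_pi]

lemma memLp_timeFrequencyShift {g : ℝ → ℂ} (hg : MemLp g 2 volume) (p : ℝ × ℝ) :
    MemLp (timeFrequencyShift g p) 2 volume := by
  have h1 : MemLp (fun x => g (x - p.1)) 2 volume :=
    hg.comp_measurePreserving (measurePreserving_sub_right volume p.1)
  refine h1.mono (h1.1.mul ?_) ?_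
  · exact Continuous.aestronglyMeasurable (by fun_prop)
  · exact Filter.Eventually.of_forall fun x => (norm_timeFrequencyShift g p x).le

lemma inner_timeFrequencyShift {S : Set ℝ} (hS : MeasurableSet S) (p q : ℝ × ℝ) :
    ‖∫ x, inner ℂ (timeFrequencyShift (charFn S) p x) (timeFrequencyShift (charFn S) q x)‖ =
      ‖ambiguity S (q - p)‖ := by
  rw [← integral_add_right_eq_self _ p.1]
  have : ∀ x : ℝ, inner ℂ (timeFrequencyShift (charFn S) p (x + p.1))
      (timeFrequencyShift (charFn S) q (x + p.1)) =
      Complex.exp (2 * Real.pi * Complex.I * p.1 * (q.2 - p.2 : ℝ)) *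
      (overlap S (q - p).1).indicator
        (fun x : ℝ => Complex.exp (2 * Real.pi * Complex.I * x * ((q - p).2 : ℝ))) x := by
    intro x
    have hx : x + p.1 - q.1 = x - (q - p).1 := by simp; ring
    simp only [timeFrequencyShift, RCLike.inner_apply, map_mul, conj_cexp_two_pi, charFn]
    rw [hx, add_sub_cancel_right]
    by_cases h1 : x ∈ S
    · by_cases h2 : x - (q - p).1 ∈ S
      · rw [indicator_of_mem h1, indicator_of_mem h2,
          indicator_of_mem (show x ∈ overlap S _ from ⟨h1, h2⟩)]
        simp only [map_one, one_mul, ← Complex.exp_add]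
        congr 1
        push_cast
        simp only [Prod.snd_sub]
        push_cast
        ring
      · rw [indicator_of_notMem h2, indicator_of_notMem (fun h : x ∈ overlap S _ => h2 h.2)]
        simp
    · rw [indicator_of_notMem h1, indicator_of_notMem (fun h : x ∈ overlap S _ => h1 h.1)]
      simp
  simp_rw [this]
  rw [integral_const_mul, norm_mul, norm_cexp_two_pi, one_mul, integral_indicator
    (measurableSet_overlap hS _)]
  rfl

lemma norm_inner_eq_ambiguity {S : Set ℝ} (hS : MeasurableSet S) (p q : ℝ × ℝ)
    (f h : Lp ℂ 2 (volume : Measure ℝ)) (hf : f =ᵐ[volume] timeFrequencyShift (charFn S) p)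
    (hh : h =ᵐ[volume] timeFrequencyShift (charFn S) q) :
    ‖inner ℂ f h‖ = ‖ambiguity S (q - p)‖ := by
  rw [← inner_timeFrequencyShift hS, L2.inner_def]
  congr 1
  apply integral_congr_ae
  filter_upwards [hf, hh] with x h1 h2
  rw [h1, h2]

lemma ambiguity_eq_zero_of_ne {S : Set ℝ} (hS : MeasurableSet S) {Λ : Set (ℝ × ℝ)}
    (hΛ : IsGaborOrthonormalBasis (charFn S) Λ) {p q : ℝ × ℝ} (hp : p ∈ Λ) (hq : q ∈ Λ)
    (hpq : p ≠ q) : ambiguity S (q - p) = 0 := by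
  obtain ⟨b, hb⟩ := hΛ
  rw [← norm_eq_zero, ← norm_inner_eq_ambiguity hS p q (b ⟨p, hp⟩) (b ⟨q, hq⟩) (hb _) (hb _),
    norm_eq_zero]
  exact b.orthonormal.2 (by simpa using hpq)

/-- Parseval's identity for the unit vector `g_z`, expanded in the basis. -/
lemma tsum_ambiguity {S : Set ℝ} (hS : MeasurableSet S) (hS1 : volume S = 1) {Λ : Set (ℝ × ℝ)}
    (hΛ : IsGaborOrthonormalBasis (charFn S) Λ) (z : ℝ × ℝ) :
    ∑' p : Λ, ‖ambiguity S (z - p)‖ₑ ^ 2 = 1 := by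
  obtain ⟨b, hb⟩ := hΛ
  have hm := memLp_timeFrequencyShift (memLp_charFn hS (by simp [hS1])) z
  set f := hm.toLp _ with hf
  have hff : f =ᵐ[volume] timeFrequencyShift (charFn S) z := hm.coeFn_toLp
  have h1 := b.hasSum_inner_mul_inner f f
  have h2 : HasSum (fun p : Λ => ‖ambiguity S (z - p)‖ ^ 2) (‖f‖ ^ 2) := by
    have := Complex.hasSum_re h1
    convert this using 2 with p
    · rw [← norm_inner_eq_ambiguity hS p z (b p) f (hb p) hff, ← inner_conj_symm f (b p),
        mul_comm, Complex.mul_conj, Complex.normSq_eq_norm_sq, Complex.ofReal_re]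
    · rw [inner_self_eq_norm_sq_to_K]
      norm_cast
  have h3 : ‖f‖ ^ 2 = 1 := by
    have hz : ambiguity S (z - z) = 1 := by
      have : overlap S 0 = S := by simp [overlap]
      simp [ambiguity, this, hS1, Measure.real]
    have := norm_inner_eq_ambiguity hS z z f f hff hff
    rw [hz, inner_self_eq_norm_sq_to_K] at this
    simpa using this
  rw [h3] at h2
  have h4 := ENNReal.ofReal_tsum_of_nonneg (fun p => by positivity) h2.summable
  rw [h2.tsum_eq, ENNReal.ofReal_one] at h4
  rw [h4]
  congr with p
  rw [ENNReal.ofReal_pow (norm_nonneg _), ofReal_norm]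

lemma measurable_ambiguity {S : Set ℝ} (hS : MeasurableSet S) :
    Measurable (fun p => ‖ambiguity S p‖ₑ ^ 2) := by
  have : StronglyMeasurable (ambiguity S) := by
    have h : ambiguity S = fun p : ℝ × ℝ => ∫ x : ℝ,
        ({q : (ℝ × ℝ) × ℝ | q.2 ∈ S ∧ q.2 - q.1.1 ∈ S}.indicator
          (fun q => Complex.exp (2 * Real.pi * Complex.I * q.2 * q.1.2))) (p, x) := by
      ext p
      rw [ambiguity, ← integral_indicator (measurableSet_overlap hS _)]
      rfl
    rw [h]
    apply StronglyMeasurable.integral_prod_right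
    apply StronglyMeasurable.indicator
    · exact Continuous.stronglyMeasurable (by fun_prop)
    · exact (measurable_snd hS).inter ((measurable_snd.sub (measurable_fst.comp measurable_fst)) hS)
  exact this.measurable.enorm.pow_const 2

/-! ### Plancherel for sets, and the integral of the squared ambiguity function -/

/-- Parseval for the Fourier series, on an interval of length `L`, of `χ_S` modulated by the
frequency `θ`. -/
lemma tsum_norm_sq_fourier {S : Set ℝ} (hS : MeasurableSet S) {L : ℝ} (hL : 0 < L)
    (hSL : S ⊆ Ico 0 L) (θ : ℝ) :
    ∑' n : ℤ, ‖∫ x in S, Complex.exp (2 * Real.pi * Complex.I * x * (θ + n / L : ℝ))‖ₑ ^ 2 =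
      ENNReal.ofReal L * volume S := by
  set h : ℝ → ℂ := S.indicator (fun x : ℝ => Complex.exp (2 * Real.pi * Complex.I * x * θ))
  have hv : volume S ≠ ∞ := ne_top_of_le_ne_top (by simp) (measure_mono hSL)
  have hh : MemLp h 2 (volume.restrict (Ioc 0 L)) := by
    have h1 : MemLp (charFn S) 2 (volume.restrict (Ioc 0 L)) := (memLp_charFn hS hv).restrict _
    refine h1.mono ?_ ?_
    · exact AEStronglyMeasurable.indicator (Continuous.aestronglyMeasurable (by fun_prop)) hS
    · refine Filter.Eventually.of_forall fun x => ?_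
      by_cases hx : x ∈ S <;> simp [h, charFn, hx, norm_cexp_two_pi]
  have h1 := hasSum_sq_fourierCoeffOn (f := h) hL hh
  have hres : (volume.restrict (Ioc 0 L)).restrict S = (volume : Measure ℝ).restrict S := by
    rw [← restrict_Ico_eq_restrict_Ioc, Measure.restrict_restrict hS, inter_eq_left.2 hSL]
  have h2 : ∫ x in (0:ℝ)..L, ‖h x‖ ^ 2 = volume.real S := by
    rw [intervalIntegral.integral_of_le hL.le]
    have : (fun x => ‖h x‖ ^ 2) = S.indicator (fun _ => (1:ℝ)) := by
      ext x
      by_cases hx : x ∈ S <;> simp [h, hx, norm_cexp_two_pi]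
    rw [this, integral_indicator hS, hres]
    simp
  have h3 : ∀ n : ℤ, fourierCoeffOn hL h (-n) =
      (1 / L : ℝ) • ∫ x in S, Complex.exp (2 * Real.pi * Complex.I * x * (θ + n / L : ℝ)) := by
    intro n
    rw [fourierCoeffOn_eq_integral, sub_zero, intervalIntegral.integral_of_le hL.le]
    congr 1
    rw [← hres, ← integral_indicator hS]
    congr with x
    by_cases hx : x ∈ S
    · simp only [h, hx, indicator_of_mem, neg_neg, fourier_coe_apply, smul_eq_mul,
        ← Complex.exp_add]
      congr 1
      push_cast
      have : (L : ℂ) ≠ 0 := by exact_mod_cast hL.ne'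
      field_simp
      ring
    · simp [h, hx]
  rw [h2, ← (Equiv.neg ℤ).hasSum_iff] at h1
  have h4 : HasSum (fun n : ℤ =>
      ‖∫ x in S, Complex.exp (2 * Real.pi * Complex.I * x * (θ + n / L : ℝ))‖ ^ 2)
      (L * volume.real S) := by
    convert! h1.mul_left (L ^ 2) using 1
    · ext n
      simp only [Function.comp, Equiv.neg_apply, h3, norm_smul, Real.norm_eq_abs, mul_pow, sq_abs]
      rw [← mul_assoc, ← mul_pow, mul_one_div_cancel hL.ne', one_pow, one_mul]
    · simp only [sub_zero, smul_eq_mul]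
      field_simp
  have h5 := ENNReal.ofReal_tsum_of_nonneg (fun p => by positivity) h4.summable
  rw [h4.tsum_eq, ENNReal.ofReal_mul hL.le, ofReal_measureReal hv] at h5
  rw [h5]
  congr with n
  rw [ENNReal.ofReal_pow (norm_nonneg _), ofReal_norm]

/-- Plancherel for `χ_S`: the frequency line is cut into cosets of `L⁻¹ℤ`, on each of which the
previous series has the constant sum `L |S|`; this is integrated over a period of length `1/L`. -/
lemma lintegral_norm_sq_fourier {S : Set ℝ} (hS : MeasurableSet S) {L : ℝ} (hL : 0 < L)
    (hSL : S ⊆ Ico 0 L)  :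
    ∫⁻ η : ℝ, ‖∫ x in S, Complex.exp (2 * Real.pi * Complex.I * x * η)‖ₑ ^ 2 = volume S := by
  have hL' : 0 < L⁻¹ := inv_pos.2 hL
  set G : ℝ → ℝ≥0∞ := fun η => ‖∫ x in S, Complex.exp (2 * Real.pi * Complex.I * x * η)‖ₑ ^ 2
  have hG : Measurable G := by
    have : StronglyMeasurable (fun η : ℝ =>
        ∫ x in S, Complex.exp (2 * Real.pi * Complex.I * x * η)) := by
      apply StronglyMeasurable.integral_prod_right
        (f := fun η x : ℝ => Complex.exp (2 * Real.pi * Complex.I * x * η))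
      exact Continuous.stronglyMeasurable (by fun_prop)
    exact this.measurable.enorm.pow_const 2
  have hfd := isAddFundamentalDomain_Ioc hL' 0 volume
  rw [hfd.lintegral_eq_tsum'' G]
  have hb : ∑' g : AddSubgroup.zmultiples L⁻¹, ∫⁻ x in Ioc 0 (0 + L⁻¹), G (g +ᵥ x) =
      ∑' n : ℤ, ∫⁻ x in Ioc 0 (0 + L⁻¹), G (x + n / L) := by
    have hinj : Function.Injective (fun n : ℤ => n • L⁻¹) := by
      intro m n hmn
      simpa [hL.ne'] using hmn
    rw [← (Equiv.ofBijective (fun n : ℤ => (⟨n • L⁻¹, n, rfl⟩ : AddSubgroup.zmultiples L⁻¹))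
      ⟨fun m n h => hinj (congrArg Subtype.val h), fun ⟨_, n, h⟩ => ⟨n, Subtype.ext h⟩⟩).tsum_eq]
    congr with n
    congr with x
    congr 1
    change n • L⁻¹ + x = _
    rw [zsmul_eq_mul, add_comm]; rfl
  have hGn : ∀ n : ℤ, Measurable fun x => G (x + n / L) := fun n =>
    hG.comp (measurable_id.add_const _)
  rw [hb, ← lintegral_tsum fun n => (hGn n).aemeasurable]
  have : ∀ x : ℝ, ∑' n : ℤ, G (x + n / L) = ENNReal.ofReal L * volume S :=
    fun x => tsum_norm_sq_fourier hS hL hSL x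
  simp_rw [this]
  simp only [zero_add, lintegral_const, Measure.restrict_apply_univ, Real.volume_Ioc, sub_zero]
  rw [mul_right_comm, ← ENNReal.ofReal_mul hL.le, mul_inv_cancel₀ hL.ne']
  simp

lemma lintegral_ambiguity {S : Set ℝ} (hS : MeasurableSet S) {L : ℝ} (hL : 0 < L)
    (hSL : S ⊆ Ico 0 L) (hS1 : volume S = 1) : ∫⁻ p, ‖ambiguity S p‖ₑ ^ 2 = 1 := by
  rw [Measure.volume_eq_prod, lintegral_prod _ (measurable_ambiguity hS).aemeasurable]
  have h1 : ∀ t : ℝ, ∫⁻ η : ℝ, ‖ambiguity S (t, η)‖ₑ ^ 2 = volume (overlap S t) := fun t =>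
    lintegral_norm_sq_fourier (measurableSet_overlap hS t) hL (inter_subset_left.trans hSL)
  simp_rw [h1]
  have h2 : ∀ t, volume (overlap S t) =
      ∫⁻ x, S.indicator 1 x * S.indicator (1 : ℝ → ℝ≥0∞) (x - t) := by
    intro t
    rw [← lintegral_indicator_one (measurableSet_overlap hS t)]
    congr with x
    by_cases h1 : x ∈ S <;> by_cases h2 : x - t ∈ S <;> simp [overlap, indicator, h1, h2]
  simp_rw [h2]
  have hm : Measurable (S.indicator (1 : ℝ → ℝ≥0∞)) := measurable_one.indicator hS
  rw [lintegral_lintegral_swap]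
  · have : ∀ x, ∫⁻ t, S.indicator 1 x * S.indicator (1 : ℝ → ℝ≥0∞) (x - t) = S.indicator 1 x := by
      intro x
      have hx : Measurable fun t => S.indicator (1 : ℝ → ℝ≥0∞) (x - t) :=
        hm.comp (measurable_const.sub measurable_id)
      rw [lintegral_const_mul _ hx,
        lintegral_sub_left_eq_self, lintegral_indicator_one hS, hS1, mul_one]
    simp_rw [this]
    rw [lintegral_indicator_one hS, hS1]
  · exact ((hm.comp measurable_snd).mul (hm.comp (measurable_snd.sub measurable_fst))).aemeasurable

/-! ### Packing by translates along `Λ` -/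

/-- Integrating `|A (z - w)|²` over the disjoint translates `E + p` gives the integral over `E` of a
sum that is identically 1, that is `|E|`. Together with the missed set `B` this is at most the total
integral, which is 1. -/
lemma packing_bound {S : Set ℝ} (hS : MeasurableSet S) {L : ℝ} (hL : 0 < L)
    (hSL : S ⊆ Ico 0 L) (hS1 : volume S = 1) {Λ : Set (ℝ × ℝ)}
    (hΛ : IsGaborOrthonormalBasis (charFn S) Λ) {E : Set (ℝ × ℝ)} (hE : MeasurableSet E)
    (hE0 : volume E ≠ 0)
    (hdisj : ∀ p ∈ Λ, ∀ q ∈ Λ, ∀ z, z - p ∈ E → z - q ∈ E → p = q)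
    {B : Set (ℝ × ℝ)} (hBE : ∀ p ∈ Λ, ∀ z ∈ B, z - p ∉ E) (z : ℝ × ℝ) :
    (∫⁻ w in B, ‖ambiguity S (z - w)‖ₑ ^ 2) + volume E ≤ 1 := by
  have hEm : ∀ p : ℝ × ℝ, MeasurableSet {w | w - p ∈ E} := fun p => (measurable_id.sub_const p) hE
  have hd : Pairwise (Function.onFun Disjoint fun p : Λ => {w | w - (p : ℝ × ℝ) ∈ E}) := by
    intro p q hpq
    rw [Function.onFun, Set.disjoint_left]
    intro w h1 h2
    exact hpq (Subtype.ext (hdisj p p.2 q q.2 w h1 h2))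
  have hvol : ∀ p : ℝ × ℝ, volume {w | w - p ∈ E} = volume E := fun p =>
    (measurePreserving_sub_right volume p).measure_preimage hE.nullMeasurableSet
  have : Countable Λ := by
    have := Measure.countable_meas_pos_of_disjoint_iUnion (μ := volume) (fun p : Λ => hEm p) hd
    rw [← countable_univ_iff]
    refine this.mono fun p _ => ?_
    change 0 < volume _
    rw [hvol]
    exact pos_iff_ne_zero.2 hE0
  set F : ℝ × ℝ → ℝ≥0∞ := fun p => ‖ambiguity S p‖ₑ ^ 2 with hF
  have hFm : Measurable F := measurable_ambiguity hS
  have hFp : ∀ p : ℝ × ℝ, Measurable fun v => F (z - v - p) := fun p =>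
    hFm.comp ((measurable_const.sub measurable_id).sub_const _)
  have h1 : ∫⁻ w in ⋃ p : Λ, {w | w - (p : ℝ × ℝ) ∈ E}, F (z - w) = volume E := by
    rw [lintegral_iUnion (fun p : Λ => hEm p) hd]
    have : ∀ p : Λ, ∫⁻ w in {w | w - (p : ℝ × ℝ) ∈ E}, F (z - w) = ∫⁻ v in E, F (z - v - p) := by
      intro p
      rw [← (measurePreserving_sub_right volume (p : ℝ × ℝ)).setLIntegral_comp_preimage hE
        (hFp p)]
      simp only [preimage, sub_sub, sub_add_cancel]
    simp_rw [this]
    rw [← lintegral_tsum fun p : Λ => (hFp p).aemeasurable]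
    simp_rw [hF, tsum_ambiguity hS hS1 hΛ]
    simp
  rw [← h1, ← lintegral_union (MeasurableSet.iUnion fun p : Λ => hEm p)]
  · refine (setLIntegral_le_lintegral _ _).trans ?_
    rw [lintegral_sub_left_eq_self F z, lintegral_ambiguity hS hL hSL hS1]
  · rw [Set.disjoint_left]
    intro w hw hw'
    obtain ⟨p, hp⟩ := mem_iUnion.1 hw'
    exact hBE p p.2 w hw hp

lemma finite_of_disjoint_translates {Λ E : Set (ℝ × ℝ)} (hE : MeasurableSet E)
    (hE0 : volume E ≠ 0)
    (hdisj : ∀ p ∈ Λ, ∀ q ∈ Λ, ∀ z, z - p ∈ E → z - q ∈ E → p = q)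
    {K : Set (ℝ × ℝ)} (hK : Bornology.IsBounded K) (hEb : Bornology.IsBounded E) :
    (Λ ∩ K).Finite := by
  have hEm : ∀ p : ℝ × ℝ, MeasurableSet {w | w - p ∈ E} := fun p => (measurable_id.sub_const p) hE
  have hd : Pairwise (Function.onFun Disjoint fun p : ↥(Λ ∩ K) => {w | w - (p : ℝ × ℝ) ∈ E}) := by
    intro p q hpq
    rw [Function.onFun, Set.disjoint_left]
    intro w h1 h2
    exact hpq (Subtype.ext (hdisj p p.2.1 q q.2.1 w h1 h2))
  have hvol : ∀ p : ℝ × ℝ, volume {w | w - p ∈ E} = volume E := fun p =>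
    (measurePreserving_sub_right volume p).measure_preimage hE.nullMeasurableSet
  have hfin := Measure.finite_const_le_meas_of_disjoint_iUnion (μ := volume)
    (pos_iff_ne_zero.2 hE0) (fun p : ↥(Λ ∩ K) => hEm p) hd (by
      refine ne_top_of_le_ne_top (hEb.add hK).measure_lt_top.ne (measure_mono ?_)
      rintro w hw
      obtain ⟨p, hp⟩ := mem_iUnion.1 hw
      exact ⟨w - p, hp, p, p.2.2, by simp⟩)
  have : Finite ↥(Λ ∩ K) := by
    rw [← finite_univ_iff]
    exact hfin.subset fun p _ => (hvol p).ge
  exact Set.toFinite _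


/-! ### Zeros of Fourier integrals of unions of intervals -/

/-- The Fourier integral of the indicator function of `[a, b)`. -/
def intervalFourier (a b η : ℝ) : ℂ :=
  ∫ x in Ico a b, Complex.exp (2 * Real.pi * Complex.I * x * η)

lemma intervalFourier_of_ge {a b : ℝ} (h : b ≤ a) (η : ℝ) : intervalFourier a b η = 0 := by
  simp [intervalFourier, Ico_eq_empty (not_lt.2 h)]

lemma intervalFourier_eq_intervalIntegral {a b : ℝ} (h : a ≤ b) (η : ℝ) :
    intervalFourier a b η = ∫ x in a..b, Complex.exp (2 * Real.pi * Complex.I * x * η) := by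
  rw [intervalIntegral.integral_of_le h, ← restrict_Ico_eq_restrict_Ioc]; rfl

lemma intervalFourier_add {a b c : ℝ} (h : a ≤ b) (h' : b ≤ c) (η : ℝ) :
    intervalFourier a b η + intervalFourier b c η = intervalFourier a c η := by
  rw [intervalFourier_eq_intervalIntegral h, intervalFourier_eq_intervalIntegral h',
    intervalFourier_eq_intervalIntegral (h.trans h')]
  have : Continuous fun x : ℝ => Complex.exp (2 * Real.pi * Complex.I * x * η) := by fun_prop
  exact intervalIntegral.integral_add_adjacent_intervals (this.intervalIntegrable _ _)
    (this.intervalIntegrable _ _)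

lemma mul_intervalFourier {a b : ℝ} (h : a ≤ b) (η : ℝ) :
    (Real.pi * η : ℂ) * intervalFourier a b η =
      (Real.sin (Real.pi * η * (b - a)) : ℂ) *
        Complex.exp ((Real.pi * η * (a + b) : ℝ) * Complex.I) := by
  rcases eq_or_ne η 0 with rfl | hη
  · simp
  have hη' : (η : ℂ) ≠ 0 := by exact_mod_cast hη
  have hpi : (Real.pi : ℂ) ≠ 0 := by exact_mod_cast Real.pi_ne_zero
  have hI := Complex.I_ne_zero
  have hc : (2 * Real.pi * Complex.I * η : ℂ) ≠ 0 := by simp [hη, Real.pi_ne_zero]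
  have h1 : ∀ x : ℝ, Complex.exp (2 * Real.pi * Complex.I * x * η) =
      Complex.exp ((2 * Real.pi * Complex.I * η) * x) := fun x => by congr 1; ring
  rw [intervalFourier_eq_intervalIntegral h]
  simp_rw [h1]
  rw [integral_exp_mul_complex hc, Complex.ofReal_sin, Complex.sin]
  have h2 : (2 * Real.pi * Complex.I * η * b : ℂ) =
      ((Real.pi * η * (b - a) : ℝ) : ℂ) * Complex.I + ((Real.pi * η * (a + b) : ℝ)) * Complex.I := by
    push_cast; ring
  have h3 : (2 * Real.pi * Complex.I * η * a : ℂ) =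
      -((Real.pi * η * (b - a) : ℝ) : ℂ) * Complex.I + ((Real.pi * η * (a + b) : ℝ)) * Complex.I := by
    push_cast; ring
  rw [h2, h3, Complex.exp_add, Complex.exp_add]
  field_simp
  rw [Complex.I_sq]
  ring

/-- Two terms `sin · exp` cancel only if their moduli agree and their phases are opposite. Total
length below `1/|η|` keeps the sine arguments in the range where equal moduli force equal lengths;
opposite phases then give the half-integer. -/
lemma lengths_eq_of_intervalFourier_add_eq_zero {a b c d η : ℝ} (hab : a ≤ b) (hcd : c ≤ d)
    (hη : η ≠ 0) (hs : 0 < (b - a) + (d - c)) (h1 : |η| * ((b - a) + (d - c)) < 1)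
    (h : intervalFourier a b η + intervalFourier c d η = 0) :
    b - a = d - c ∧ ∃ n : ℤ, η * (c - a) = n + 1 / 2 := by
  have hpi := Real.pi_pos
  have e := congrArg (fun z => (Real.pi * η : ℂ) * z) h
  simp only [mul_zero] at e
  rw [mul_add, mul_intervalFourier hab, mul_intervalFourier hcd] at e
  set x := Real.pi * η * (b - a) with hx
  set y := Real.pi * η * (d - c) with hy
  have hxy : x + y ≠ 0 := by
    rw [hx, hy, ← mul_add]
    exact mul_ne_zero (mul_ne_zero hpi.ne' hη) hs.ne'
  have hxyp : |x + y| < Real.pi := by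
    rw [hx, hy, ← mul_add, abs_mul, abs_mul, abs_of_pos hpi, abs_of_pos hs, mul_assoc]
    exact mul_lt_of_lt_one_right hpi h1
  have hxyp' : |x - y| < Real.pi := by
    refine lt_of_le_of_lt ?_ hxyp
    rw [hx, hy, ← mul_sub, ← mul_add, abs_mul, abs_mul _ (b - a + (d - c))]
    refine mul_le_mul_of_nonneg_left ?_ (abs_nonneg _)
    rw [abs_le, abs_of_pos hs]
    constructor <;> linarith
  have hsq : Real.sin x ^ 2 = Real.sin y ^ 2 := by
    have := congrArg norm (eq_neg_of_add_eq_zero_left e)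
    rw [norm_neg, norm_mul, norm_mul, Complex.norm_exp_ofReal_mul_I, Complex.norm_exp_ofReal_mul_I,
      mul_one, mul_one, Complex.norm_real, Complex.norm_real, Real.norm_eq_abs,
      Real.norm_eq_abs] at this
    rw [← sq_abs, this, sq_abs]
  -- The identity `sin² x - sin² y = sin (x + y) sin (x - y)`, where both arguments lie in `(-π,
  -- π)`.
  have hprod : Real.sin (x + y) * Real.sin (x - y) = 0 := by
    rw [Real.sin_add, Real.sin_sub]
    have h2 := Real.sin_sq_add_cos_sq x
    have h3 := Real.sin_sq_add_cos_sq y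
    have h4 : Real.cos y ^ 2 = 1 - Real.sin y ^ 2 := by linarith
    have h5 : Real.cos x ^ 2 = 1 - Real.sin x ^ 2 := by linarith
    ring_nf
    rw [h4, h5, hsq]
    ring
  have hxeq : x = y := by
    rcases mul_eq_zero.1 hprod with h2 | h2
    · exact absurd ((Real.sin_eq_zero_iff_of_lt_of_lt (abs_lt.1 hxyp).1 (abs_lt.1 hxyp).2).1 h2) hxy
    · linarith [(Real.sin_eq_zero_iff_of_lt_of_lt (abs_lt.1 hxyp').1 (abs_lt.1 hxyp').2).1 h2]
  have hlen : b - a = d - c := mul_left_cancel₀ (mul_ne_zero hpi.ne' hη) hxeq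
  refine ⟨hlen, ?_⟩
  have hsx : Real.sin y ≠ 0 := by
    intro h0
    have h2 : |y| < Real.pi := by
      rw [hxeq, ← two_mul, abs_mul, abs_two] at hxyp
      linarith [abs_nonneg y]
    have := (Real.sin_eq_zero_iff_of_lt_of_lt (abs_lt.1 h2).1 (abs_lt.1 h2).2).1 h0
    exact hxy (by rw [hxeq, this, add_zero])
  rw [hxeq, ← mul_add] at e
  have e2 := (mul_eq_zero.1 e).resolve_left (by exact_mod_cast hsx)
  have h6 : ((Real.pi * η * (c + d) : ℝ) : ℂ) * Complex.I =
      ((Real.pi * η * (a + b) : ℝ) : ℂ) * Complex.I +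
        ((2 * Real.pi * η * (c - a) : ℝ) : ℂ) * Complex.I := by
    have : d = b - a + c := by linarith
    rw [this]
    push_cast; ring
  rw [h6, Complex.exp_add] at e2
  have e3 : Complex.exp (((2 * Real.pi * η * (c - a) : ℝ) : ℂ) * Complex.I) = -1 := by
    have hne := Complex.exp_ne_zero (((Real.pi * η * (a + b) : ℝ) : ℂ) * Complex.I)
    apply mul_left_cancel₀ hne
    linear_combination e2
  have e4 := congrArg Complex.re e3
  rw [Complex.exp_ofReal_mul_I_re] at e4
  simp only [Complex.neg_re, Complex.one_re] at e4
  obtain ⟨n, hn⟩ := (Real.cos_eq_neg_one_iff).1 e4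
  refine ⟨n, ?_⟩
  have : 2 * Real.pi * (η * (c - a)) = 2 * Real.pi * (n + 1 / 2) := by linarith
  exact mul_left_cancel₀ (by positivity) this

lemma intervalFourier_ne_zero {a b η : ℝ} (hab : a < b) (hη : η ≠ 0) (h1 : |η| * (b - a) < 1) :
    intervalFourier a b η ≠ 0 := by
  intro h
  have := (lengths_eq_of_intervalFourier_add_eq_zero (a := 0) (b := 0) le_rfl hab.le hη (by simpa)
    (by simpa) (by rw [h, intervalFourier_of_ge le_rfl, add_zero])).1
  linarith

/-- The three pieces are `[τ, 1 + β)` minus two gaps of equal length `β`. Dividing by the phase of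
the midpoint between the gaps makes their contribution real, so the imaginary part of the full
interval's term must vanish; it is a product of two sines of `πη` times lengths in `(0, 1]`. -/
lemma three_intervalFourier_ne_zero {α β τ η : ℝ} (hβ : 0 < β) (h1 : β < τ) (h2 : τ < α)
    (h3 : α < 1 / 2) (hη : η ≠ 0) (hη1 : |η| < 1) :
    intervalFourier τ α η + intervalFourier (α + β) (τ + α) η +
      intervalFourier (α + β + τ) (1 + β) η ≠ 0 := by
  intro h
  have hpi := Real.pi_pos
  have a1 := intervalFourier_add (a := τ) (b := α) (c := α + β) (by linarith) (by linarith) η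
  have a2 := intervalFourier_add (a := τ) (b := α + β) (c := τ + α) (by linarith) (by linarith) η
  have a3 := intervalFourier_add (a := τ) (b := τ + α) (c := α + β + τ)
    (by linarith) (by linarith) η
  have a4 := intervalFourier_add (a := τ) (b := α + β + τ) (c := 1 + β)
    (by linarith) (by linarith) η
  have key : intervalFourier τ (1 + β) η =
      intervalFourier α (α + β) η + intervalFourier (τ + α) (α + β + τ) η := by
    linear_combination h - a1 - a2 - a3 - a4
  have e := congrArg (fun z => (Real.pi * η : ℂ) * z) key
  simp only [mul_add] at e
  rw [mul_intervalFourier (by linarith), mul_intervalFourier (by linarith),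
    mul_intervalFourier (by linarith)] at e
  set c := Real.pi * η * (2 * α + β + τ) with hc
  have b1 : ((Real.pi * η * (τ + (1 + β)) : ℝ) : ℂ) * Complex.I =
      c * Complex.I + (Real.pi * η * (1 - 2 * α) : ℝ) * Complex.I := by
    rw [hc]; push_cast; ring
  have b2 : ((Real.pi * η * (α + (α + β)) : ℝ) : ℂ) * Complex.I =
      c * Complex.I + (-(Real.pi * η * τ) : ℝ) * Complex.I := by
    rw [hc]; push_cast; ring
  have b3 : ((Real.pi * η * (τ + α + (α + β + τ)) : ℝ) : ℂ) * Complex.I =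
      c * Complex.I + ((Real.pi * η * τ) : ℝ) * Complex.I := by
    rw [hc]; push_cast; ring
  have l1 : α + β - α = β := by ring
  have l2 : α + β + τ - (τ + α) = β := by ring
  rw [b1, b2, b3, Complex.exp_add, Complex.exp_add, Complex.exp_add, l1, l2] at e
  have hne := Complex.exp_ne_zero ((c : ℂ) * Complex.I)
  have e2 : (Real.sin (Real.pi * η * (1 + β - τ)) : ℂ) *
        Complex.exp ((Real.pi * η * (1 - 2 * α) : ℝ) * Complex.I) =
      (Real.sin (Real.pi * η * β) : ℂ) * Complex.exp ((-(Real.pi * η * τ) : ℝ) * Complex.I) +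
      (Real.sin (Real.pi * η * β) : ℂ) * Complex.exp ((Real.pi * η * τ : ℝ) * Complex.I) := by
    apply mul_left_cancel₀ hne
    linear_combination e
  have e3 := congrArg Complex.im e2
  rw [Complex.add_im, Complex.im_ofReal_mul, Complex.im_ofReal_mul, Complex.im_ofReal_mul,
    Complex.exp_ofReal_mul_I_im, Complex.exp_ofReal_mul_I_im, Complex.exp_ofReal_mul_I_im,
    Real.sin_neg] at e3
  have nz : ∀ l : ℝ, 0 < l → l ≤ 1 → Real.sin (Real.pi * η * l) ≠ 0 := by
    intro l hl hl1 h0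
    have : |Real.pi * η * l| < Real.pi := by
      rw [abs_mul, abs_mul, abs_of_pos hpi, abs_of_pos hl, mul_assoc]
      refine mul_lt_of_lt_one_right hpi ?_
      nlinarith [abs_nonneg η]
    have := (Real.sin_eq_zero_iff_of_lt_of_lt (abs_lt.1 this).1 (abs_lt.1 this).2).1 h0
    exact mul_ne_zero (mul_ne_zero hpi.ne' hη) hl.ne' this
  have : Real.sin (Real.pi * η * (1 + β - τ)) * Real.sin (Real.pi * η * (1 - 2 * α)) = 0 := by
    rw [e3]; ring
  rcases mul_eq_zero.1 this with h0 | h0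
  · exact nz _ (by linarith) (by linarith) h0
  · exact nz _ (by linarith) (by linarith) h0

/-! ### The ambiguity function of two intervals -/

lemma measurableSet_twoIntervals (α β : ℝ) : MeasurableSet (twoIntervals α β) :=
  measurableSet_Ico.union measurableSet_Ico

lemma mem_twoIntervals {α β x : ℝ} :
    x ∈ twoIntervals α β ↔ (0 ≤ x ∧ x < α) ∨ (α + β ≤ x ∧ x < 1 + β) := Iff.rfl

lemma volume_twoIntervals {α β : ℝ} (hα : 0 ≤ α) (hα' : α < 1 / 2) (hβ : 0 < β) :
    volume (twoIntervals α β) = 1 := by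
  rw [twoIntervals, measure_union _ measurableSet_Ico, Real.volume_Ico, Real.volume_Ico,
    ← ENNReal.ofReal_add (by linarith) (by linarith)]
  · simp
  · rw [Set.disjoint_left]
    rintro x ⟨_, h1⟩ ⟨h2, _⟩
    linarith

lemma twoIntervals_subset {α β : ℝ} (hα : 0 ≤ α) (hα' : α < 1 / 2) (hβ : 0 < β) :
    twoIntervals α β ⊆ Ico 0 (1 + β) := by
  rintro x (⟨h1, h2⟩ | ⟨h1, h2⟩) <;> constructor <;> linarith

lemma ambiguity_twoIntervals {α β τ : ℝ} (hβ : 0 < β) (hτ : 0 ≤ τ)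
    (η : ℝ) : ambiguity (twoIntervals α β) (τ, η) =
      intervalFourier τ α η + intervalFourier (max (α + β) τ) (min (1 + β) (τ + α)) η +
        intervalFourier (α + β + τ) (1 + β) η := by
  have hset : overlap (twoIntervals α β) τ =
      (Ico τ α ∪ Ico (max (α + β) τ) (min (1 + β) (τ + α))) ∪ Ico (α + β + τ) (1 + β) := by
    ext x
    simp only [overlap, mem_inter_iff, mem_twoIntervals, mem_union, mem_Ico, max_le_iff, lt_min_iff]
    change ((0 ≤ x ∧ x < α) ∨ (α + β ≤ x ∧ x < 1 + β)) ∧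
      (x - τ ∈ twoIntervals α β) ↔ _
    rw [mem_twoIntervals]
    constructor
    · rintro ⟨h1 | h1, h2 | h2⟩
      · left; left; constructor <;> linarith
      · exfalso; linarith
      · left; right; refine ⟨⟨?_, ?_⟩, ?_, ?_⟩ <;> linarith
      · right; constructor <;> linarith
    · rintro ((h | h) | h)
      · exact ⟨Or.inl (by constructor <;> linarith), Or.inl (by constructor <;> linarith)⟩
      · exact ⟨Or.inr ⟨h.1.1, h.2.1⟩, Or.inl ⟨by linarith, by linarith⟩⟩
      · exact ⟨Or.inr ⟨by linarith, h.2⟩, Or.inr ⟨by linarith, by linarith⟩⟩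
  have hcont : Continuous fun x : ℝ => Complex.exp (2 * Real.pi * Complex.I * x * η) := by fun_prop
  have hint : ∀ a b : ℝ, IntegrableOn
      (fun x : ℝ => Complex.exp (2 * Real.pi * Complex.I * x * η)) (Ico a b) := fun a b =>
    (hcont.integrableOn_Icc (a := a) (b := b)).mono_set Ico_subset_Icc_self
  rw [ambiguity]
  simp only [hset]
  rw [setIntegral_union _ measurableSet_Ico ((hint _ _).union (hint _ _)) (hint _ _),
    setIntegral_union _ measurableSet_Ico (hint _ _) (hint _ _)]
  · rfl
  · rw [Set.disjoint_left]
    rintro x ⟨_, h1⟩ ⟨h2, _⟩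
    linarith [le_max_left (α + β) τ]
  · rw [Set.disjoint_left]
    rintro x (⟨_, h1⟩ | ⟨_, h1⟩) ⟨h2, _⟩
    · linarith
    · linarith [min_le_right (1 + β) (τ + α)]

/-- At frequency 0 the ambiguity is the measure of the overlap, and half-open intervals meet either
not at all or in positive measure. -/
lemma ambiguity_zero_ne_zero {α β τ : ℝ}
    (h : (overlap (twoIntervals α β) τ).Nonempty) (hfin : volume (twoIntervals α β) ≠ ∞) :
    ambiguity (twoIntervals α β) (τ, 0) ≠ 0 := by
  have hloc : ∀ x ∈ twoIntervals α β, ∃ δ > 0, Ico x (x + δ) ⊆ twoIntervals α β := by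
    rintro x (⟨h1, h2⟩ | ⟨h1, h2⟩)
    · refine ⟨α - x, by linarith, fun y hy => Or.inl ⟨by linarith [hy.1], by linarith [hy.2]⟩⟩
    · refine ⟨1 + β - x, by linarith, fun y hy => Or.inr ⟨by linarith [hy.1], by linarith [hy.2]⟩⟩
  obtain ⟨x, h1, h2⟩ := h
  obtain ⟨δ₁, p1, s1⟩ := hloc x h1
  obtain ⟨δ₂, p2, s2⟩ := hloc _ h2
  have hsub : Ico x (x + min δ₁ δ₂) ⊆ overlap (twoIntervals α β) τ := fun y hy =>
    ⟨s1 ⟨hy.1, by linarith [hy.2, min_le_left δ₁ δ₂]⟩,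
      s2 ⟨by linarith [hy.1], by linarith [hy.2, min_le_right δ₁ δ₂]⟩⟩
  have hpos : 0 < volume (overlap (twoIntervals α β) τ) := by
    refine lt_of_lt_of_le ?_ (measure_mono hsub)
    simp [p1, p2]
  have hfin' : volume (overlap (twoIntervals α β) τ) ≠ ∞ :=
    ne_top_of_le_ne_top hfin (measure_mono inter_subset_left)
  have : (volume.real (overlap (twoIntervals α β) τ)) ≠ 0 :=
    (ENNReal.toReal_pos hpos.ne' hfin').ne'
  simpa [ambiguity] using this

lemma norm_ambiguity_neg {S : Set ℝ} (hS : MeasurableSet S) (p : ℝ × ℝ) :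
    ‖ambiguity S (-p)‖ = ‖ambiguity S p‖ := by
  have h1 := inner_timeFrequencyShift hS 0 p
  have h2 := inner_timeFrequencyShift hS p 0
  rw [sub_zero] at h1
  rw [zero_sub] at h2
  rw [← h1, ← h2, ← Complex.norm_conj, ← integral_conj]
  simp_rw [inner_conj_symm]

lemma overlap_neg_nonempty {S : Set ℝ} {t : ℝ} (h : (overlap S t).Nonempty) :
    (overlap S (-t)).Nonempty := by
  obtain ⟨x, h1, h2⟩ := h
  exact ⟨x - t, h2, by change x - t - -t ∈ S; simpa using h1⟩

/-- With `α = 0` or a long gap, the overlap consists of one interval, or of two of the unequal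
lengths `α - τ` and `1 - α - τ`, so no cancellation is possible. -/
lemma ambiguity_ne_zero_of_nonneg {α β τ η : ℝ} (hα : 0 ≤ α) (hα' : α < 1 / 2) (hβ : 0 < β)
    (hαβ : α = 0 ∨ 1 - α ≤ β) (hτ : 0 ≤ τ) (hη : |η| ≤ 1) (h : |η| < 1 ∨ 0 < τ)
    (hne : (overlap (twoIntervals α β) τ).Nonempty) :
    ambiguity (twoIntervals α β) (τ, η) ≠ 0 := by
  rcases eq_or_ne η 0 with rfl | hη0
  · exact ambiguity_zero_ne_zero hne (by simp [volume_twoIntervals hα hα' hβ])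
  -- A shift `τ > 0` leaves total length below 1, which is why `|η| = 1` is admissible there.
  have hlen : ∀ l : ℝ, 0 ≤ l → l + τ ≤ 1 → |η| * l < 1 := by
    intro l h0 h1
    rcases h with h | h
    · nlinarith [abs_nonneg η]
    · nlinarith [abs_nonneg η]
  rw [ambiguity_twoIntervals hβ hτ]
  obtain ⟨x, h1, h2⟩ := hne
  change x - τ ∈ twoIntervals α β at h2
  rw [mem_twoIntervals] at h1 h2
  rcases lt_or_ge τ α with h3 | h3
  · have h4 : 1 - α ≤ β := hαβ.resolve_left (by linarith)
    have h5 : min (1 + β) (τ + α) ≤ max (α + β) τ :=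
      (min_le_right _ _).trans (le_trans (by linarith) (le_max_left _ _))
    rw [intervalFourier_of_ge h5, add_zero]
    intro h0
    have := (lengths_eq_of_intervalFourier_add_eq_zero h3.le (by linarith) hη0 (by linarith)
      (hlen _ (by linarith) (by linarith)) h0).1
    linarith
  · rw [intervalFourier_of_ge h3, zero_add]
    by_cases h4 : τ < 1 - α ∧ (α = 0 ∨ τ ≤ β)
    · have h5 : min (1 + β) (τ + α) ≤ max (α + β) τ := by
        rcases h4.2 with h6 | h6
        · exact (min_le_right _ _).trans (le_trans (by linarith) (le_max_right _ _))
        · exact (min_le_right _ _).trans (le_trans (by linarith) (le_max_left _ _))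
      rw [intervalFourier_of_ge h5, zero_add]
      exact intervalFourier_ne_zero (by linarith) hη0 (hlen _ (by linarith) (by linarith))
    · rcases eq_or_lt_of_le hα with h0 | h0
      · exfalso
        subst h0
        apply h4
        refine ⟨?_, Or.inl rfl⟩
        rcases h1 with h1 | h1 <;> rcases h2 with h2 | h2 <;> linarith
      · have hβ1 : 1 - α ≤ β := hαβ.resolve_left h0.ne'
        have h5 : 1 - α ≤ τ := by
          by_contra! h6
          exact h4 ⟨h6, Or.inr (by linarith)⟩
        rw [intervalFourier_of_ge (a := α + β + τ) (by linarith), add_zero]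
        refine intervalFourier_ne_zero ?_ hη0 ?_
        · rw [max_lt_iff, lt_min_iff, lt_min_iff]
          rcases h1 with h1 | h1 <;> rcases h2 with h2 | h2 <;>
            refine ⟨⟨?_, ?_⟩, ?_, ?_⟩ <;> linarith
        · have : min (1 + β) (τ + α) - max (α + β) τ ≤ α := by
            linarith [min_le_right (1 + β) (τ + α), le_max_right (α + β) τ]
          nlinarith [abs_nonneg η]

lemma ambiguity_ne_zero {α β τ η : ℝ} (hα : 0 ≤ α) (hα' : α < 1 / 2) (hβ : 0 < β)
    (hαβ : α = 0 ∨ 1 - α ≤ β) (hη : |η| ≤ 1) (h : |η| < 1 ∨ τ ≠ 0)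
    (hne : (overlap (twoIntervals α β) τ).Nonempty) :
    ambiguity (twoIntervals α β) (τ, η) ≠ 0 := by
  rcases le_or_gt 0 τ with hτ | hτ
  · exact ambiguity_ne_zero_of_nonneg hα hα' hβ hαβ hτ hη
      (h.imp_right fun h => lt_of_le_of_ne hτ h.symm) hne
  · rw [← norm_ne_zero_iff, ← norm_ambiguity_neg (measurableSet_twoIntervals α β), norm_ne_zero_iff]
    exact ambiguity_ne_zero_of_nonneg hα hα' hβ hαβ (by linarith) (by simpa using hη)
      (Or.inr (by linarith)) (overlap_neg_nonempty hne)

/-- Cancellation needs two pieces of equal length. For `τ ≤ β` the lengths `α - τ` and `1 - α - τ`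
differ; for `β < τ < α` there are three pieces. What remains are the pieces of lengths `min (τ - β)
α` and `1 - α - τ`, and the two values of the minimum give the two alternatives. -/
lemma zeros_of_ambiguity {α β τ η : ℝ} (hα : 0 < α) (hα' : α < 1 / 2) (hβ : 0 < β)
    (hαβ : β < 1 - α) (hτ : 0 ≤ τ) (hτ' : τ < 1 + β) (hη : |η| < 1)
    (h : ambiguity (twoIntervals α β) (τ, η) = 0) :
    (1 - 3 * α ≤ β ∧ τ = (1 - α + β) / 2 ∧ |η| * (1 - α + β) = 1) ∨
      (β < 1 - 3 * α ∧ τ = 1 - 2 * α ∧ |η| * (2 * (α + β)) = 1) := by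
  have hη0 : η ≠ 0 := by
    rintro rfl
    refine ambiguity_zero_ne_zero ?_ (by simp [volume_twoIntervals hα.le hα' hβ]) h
    rcases lt_or_ge τ (1 - α) with h1 | h1
    · refine ⟨α + β + τ, ?_, ?_⟩
      · rw [mem_twoIntervals]; right; constructor <;> linarith
      · change _ - τ ∈ twoIntervals α β; rw [mem_twoIntervals]; right; constructor <;> linarith
    · refine ⟨max (α + β) τ, Or.inr ⟨le_max_left _ _, max_lt (by linarith) hτ'⟩, ?_⟩
      change _ - τ ∈ twoIntervals α β; left
      have := le_max_right (α + β) τ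
      refine ⟨by linarith, ?_⟩
      rw [sub_lt_iff_lt_add]
      exact max_lt (by linarith) (by linarith)
  have hlen : ∀ l : ℝ, 0 ≤ l → l ≤ 1 → |η| * l < 1 := by
    intro l h0 h1
    nlinarith [abs_nonneg η]
  rw [ambiguity_twoIntervals hβ hτ] at h
  rcases le_or_gt τ β with h1 | h1
  · exfalso
    have h5 : min (1 + β) (τ + α) ≤ max (α + β) τ :=
      (min_le_right _ _).trans (le_trans (by linarith) (le_max_left _ _))
    rw [intervalFourier_of_ge h5, add_zero] at h
    rcases lt_or_ge τ α with h3 | h3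
    · have := (lengths_eq_of_intervalFourier_add_eq_zero h3.le (by linarith) hη0 (by linarith)
        (hlen _ (by linarith) (by linarith)) h).1
      linarith
    · rw [intervalFourier_of_ge h3, zero_add] at h
      exact intervalFourier_ne_zero (by linarith) hη0 (hlen _ (by linarith) (by linarith)) h
  rcases lt_or_ge τ α with h3 | h3
  · exfalso
    rw [max_eq_left (by linarith), min_eq_right (by linarith)] at h
    exact three_intervalFourier_ne_zero hβ h1 h3 hα' hη0 hη h
  rw [intervalFourier_of_ge h3, zero_add] at h
  rcases le_or_gt (1 - α) τ with h4 | h4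
  · exfalso
    rw [intervalFourier_of_ge (a := α + β + τ) (by linarith), add_zero] at h
    refine intervalFourier_ne_zero ?_ hη0 ?_ h
    · rw [max_lt_iff, lt_min_iff, lt_min_iff]
      refine ⟨⟨?_, ?_⟩, ?_, ?_⟩ <;> linarith
    · have : min (1 + β) (τ + α) - max (α + β) τ ≤ α := by
        linarith [min_le_right (1 + β) (τ + α), le_max_right (α + β) τ]
      nlinarith [abs_nonneg η]
  rw [min_eq_right (by linarith : τ + α ≤ 1 + β)] at h
  -- As `|η d| < 1`, the half-integer can only be `1/2` or `-1/2`.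
  have half : ∀ d : ℝ, 0 < d → d < 1 → (∃ n : ℤ, η * d = n + 1 / 2) → |η| * d = 1 / 2 := by
    rintro d hd hd1 ⟨n, hn⟩
    have h6 : |η * d| < 1 := by
      rw [abs_mul, abs_of_pos hd]; nlinarith [abs_nonneg η]
    rw [hn, abs_lt] at h6
    have h7 : (-2 : ℝ) < n := by linarith
    have h8 : (n : ℝ) < 1 := by linarith
    have h7' : -2 < n := by exact_mod_cast h7
    have h8' : n < 1 := by exact_mod_cast h8
    have : |η * d| = 1 / 2 := by
      rw [hn]
      obtain rfl | rfl : n = 0 ∨ n = -1 := by omega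
      · norm_num
      · norm_num
    rwa [abs_mul, abs_of_pos hd] at this
  rcases le_or_gt τ (α + β) with h5 | h5
  · left
    rw [max_eq_left h5] at h
    obtain ⟨e1, e2⟩ := lengths_eq_of_intervalFourier_add_eq_zero (by linarith) (by linarith) hη0
      (by linarith) (hlen _ (by linarith) (by linarith)) h
    have hτ2 : τ = (1 - α + β) / 2 := by linarith
    have e3 := half τ (by linarith) (by linarith) (by convert e2 using 4; ring)
    refine ⟨by linarith, hτ2, ?_⟩
    rw [hτ2] at e3
    linarith
  · right
    rw [max_eq_right h5.le] at h
    obtain ⟨e1, e2⟩ := lengths_eq_of_intervalFourier_add_eq_zero (by linarith) (by linarith) hη0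
      (by linarith) (hlen _ (by linarith) (by linarith)) h
    have hτ2 : τ = 1 - 2 * α := by linarith
    have e3 := half (α + β) (by linarith) (by linarith) (by convert e2 using 4; ring)
    exact ⟨by linarith, hτ2, by linarith⟩

/-- At the frequency `1` and for a nondegenerate pair of intervals, orthogonality forces the gap
to be an integer. -/
lemma exists_int_of_ambiguity_eq_zero {α β : ℝ} (hα : 0 < α) (hα' : α < 1 / 2) (hβ : 0 < β)
    (h : ambiguity (twoIntervals α β) (0, 1) = 0) : ∃ m : ℤ, β = m := by
  have hpi : (Real.pi : ℂ) ≠ 0 := by exact_mod_cast Real.pi_ne_zero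
  rw [ambiguity_twoIntervals hβ le_rfl, intervalFourier_of_ge (a := max (α + β) 0)
    ((min_le_right _ _).trans (le_trans (by linarith) (le_max_left _ _))), add_zero] at h
  have e := congrArg (fun z => (Real.pi * (1 : ℝ) : ℂ) * z) h
  simp only [mul_add, mul_zero] at e
  rw [mul_intervalFourier hα.le, mul_intervalFourier (by linarith)] at e
  -- At frequency 1 the lengths `α` and `1 - α` have equal sines, so only the phases, which differ
  -- through `β`, must be compared.
  have hs : Real.sin (Real.pi * 1 * (1 + β - (α + β + 0))) = Real.sin (Real.pi * 1 * (α - 0)) := by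
    rw [← Real.sin_pi_sub]
    congr 1; ring
  rw [hs, ← mul_add] at e
  have hsin : Real.sin (Real.pi * 1 * (α - 0)) ≠ 0 := by
    refine (Real.sin_pos_of_pos_of_lt_pi ?_ ?_).ne'
    · simp [hα, Real.pi_pos]
    · nlinarith [Real.pi_pos]
  have e2 := (mul_eq_zero.1 e).resolve_left (by exact_mod_cast hsin)
  have h6 : ((Real.pi * 1 * (α + β + 0 + (1 + β)) : ℝ) : ℂ) * Complex.I =
      ((Real.pi * 1 * (0 + α) : ℝ) : ℂ) * Complex.I +
        ((Real.pi * (2 * β) : ℝ) : ℂ) * Complex.I + Real.pi * Complex.I := by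
    push_cast; ring
  rw [h6, Complex.exp_add, Complex.exp_add, Complex.exp_pi_mul_I] at e2
  have e3 : Complex.exp (((Real.pi * (2 * β) : ℝ) : ℂ) * Complex.I) = 1 := by
    have hne := Complex.exp_ne_zero (((Real.pi * 1 * (0 + α) : ℝ) : ℂ) * Complex.I)
    apply mul_left_cancel₀ hne
    linear_combination -e2
  have e4 := congrArg Complex.re e3
  rw [Complex.exp_ofReal_mul_I_re] at e4
  simp only [Complex.one_re] at e4
  obtain ⟨n, hn⟩ := (Real.cos_eq_one_iff _).1 e4
  refine ⟨n, ?_⟩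
  have : (2 * Real.pi) * β = (2 * Real.pi) * n := by linarith
  exact mul_left_cancel₀ (by positivity) this


/-! ### Tilings of the line by two intervals -/

section TilingByTwoIntervals

variable {α β : ℝ} {T : Set ℝ}

/-- A tiling has no proper subfamily that covers. The test point is the left end of the long
interval, which is nonempty even when `α = 0`. -/
lemma mem_of_subset_of_cover {S : Set ℝ} (hα' : α < 1 / 2)
    (huniq : ∀ t ∈ T, ∀ t' ∈ T, ∀ x, x - t ∈ twoIntervals α β → x - t' ∈ twoIntervals α β → t = t')
    (hST : S ⊆ T) (hS : ∀ x, ∃ t ∈ S, x - t ∈ twoIntervals α β) : T ⊆ S := by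
  intro t ht
  obtain ⟨t', ht', hx⟩ := hS (t + (α + β))
  rwa [huniq t ht t' (hST ht') (t + (α + β)) (Or.inr ⟨by linarith, by linarith⟩) hx]

/-- `T + c` is contained in `T` and still covers, hence equals `T`. -/
lemma sub_mem_of_forall_add_mem (hα' : α < 1 / 2)
    (hex : ∀ x, ∃ t ∈ T, x - t ∈ twoIntervals α β)
    (huniq : ∀ t ∈ T, ∀ t' ∈ T, ∀ x, x - t ∈ twoIntervals α β → x - t' ∈ twoIntervals α β → t = t')
    {c : ℝ} (h : ∀ t ∈ T, t + c ∈ T) : ∀ t ∈ T, t - c ∈ T := by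
  have h1 : {t | t - c ∈ T} ⊆ T := fun t ht => by
    have := h _ ht
    rwa [sub_add_cancel] at this
  refine fun t ht => mem_of_subset_of_cover hα' huniq h1 (fun x => ?_) ht
  obtain ⟨t, ht, hx⟩ := hex (x - c)
  refine ⟨t + c, ?_, ?_⟩
  · change t + c - c ∈ T
    rwa [add_sub_cancel_right]
  · rwa [show x - (t + c) = x - c - t by ring]

/-- The point `t + α` opens the gap of the tile at `t`. Only the left end of another tile's long
interval can sit there, because every other position overlaps the tile at `t`. -/
lemma tiling_sub_gap_mem (hα : 0 < α) (hα' : α < 1 / 2) (hβ : 0 < β)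
    (hex : ∀ x, ∃ t ∈ T, x - t ∈ twoIntervals α β)
    (huniq : ∀ t ∈ T, ∀ t' ∈ T, ∀ x, x - t ∈ twoIntervals α β → x - t' ∈ twoIntervals α β → t = t')
    {t : ℝ} (ht : t ∈ T) : t - β ∈ T := by
  obtain ⟨u, hu, ⟨h1, h2⟩ | ⟨h1, h2⟩⟩ := hex (t + α)
  · exfalso
    rcases eq_or_lt_of_le h1 with h3 | h3
    · have := huniq t ht u hu (t + 2 * α + β) (Or.inr ⟨by linarith, by linarith⟩)
        (Or.inr ⟨by linarith, by linarith⟩)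
      linarith
    · have := huniq t ht u hu u (Or.inl ⟨by linarith, by linarith⟩)
        (Or.inl ⟨by linarith, by linarith⟩)
      linarith
  · rcases eq_or_lt_of_le h1 with h3 | h3
    · rwa [show t - β = u by linarith]
    · exfalso
      have := huniq t ht u hu (max (u + α + β) t)
        (Or.inl ⟨by linarith [le_max_right (u + α + β) t], by
          rw [sub_lt_iff_lt_add]; exact max_lt (by linarith) (by linarith)⟩)
        (Or.inr ⟨by linarith [le_max_left (u + α + β) t], by
          rw [sub_lt_iff_lt_add]; exact max_lt (by linarith) (by linarith)⟩)
      linarith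

/-- The point `t + (1 + β)` follows the tile at `t` immediately, and only the left end of a short
interval can sit there. -/
lemma tiling_add_length_mem (hα : 0 < α) (hα' : α < 1 / 2) (hβ : 0 < β)
    (hex : ∀ x, ∃ t ∈ T, x - t ∈ twoIntervals α β)
    (huniq : ∀ t ∈ T, ∀ t' ∈ T, ∀ x, x - t ∈ twoIntervals α β → x - t' ∈ twoIntervals α β → t = t')
    {t : ℝ} (ht : t ∈ T) : t + (1 + β) ∈ T := by
  obtain ⟨u, hu, ⟨h1, h2⟩ | ⟨h1, h2⟩⟩ := hex (t + (1 + β))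
  · rcases eq_or_lt_of_le h1 with h3 | h3
    · rwa [show t + (1 + β) = u by linarith]
    · exfalso
      have := huniq t ht u hu (max u (t + α + β))
        (Or.inr ⟨by linarith [le_max_right u (t + α + β)], by
          rw [sub_lt_iff_lt_add]; exact max_lt (by linarith) (by linarith)⟩)
        (Or.inl ⟨by linarith [le_max_left u (t + α + β)], by
          rw [sub_lt_iff_lt_add]; exact max_lt (by linarith) (by linarith)⟩)
      linarith
  · exfalso
    rcases eq_or_lt_of_le h1 with h3 | h3
    -- Here `u = t + 1 - α`, and the conflict is with the long interval `[t + α, t + 1)` of the tile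
    -- at `t - β`.
    · have hv := tiling_sub_gap_mem hα hα' hβ hex huniq ht
      have := huniq (t - β) hv u hu u (Or.inr ⟨by linarith, by linarith⟩)
        (Or.inl ⟨by linarith, by linarith⟩)
      linarith
    · have := huniq t ht u hu (max u t + (α + β))
        (Or.inr ⟨by linarith [le_max_right u t], by
          have : max u t < t + 1 - α := max_lt (by linarith) (by linarith)
          linarith⟩)
        (Or.inr ⟨by linarith [le_max_left u t], by
          have : max u t < u + 1 - α := max_lt (by linarith) (by linarith)
          linarith⟩)
      linarith

lemma tiling_add_one_mem (hα : 0 ≤ α) (hα' : α < 1 / 2) (hβ : 0 < β)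
    (hex : ∀ x, ∃ t ∈ T, x - t ∈ twoIntervals α β)
    (huniq : ∀ t ∈ T, ∀ t' ∈ T, ∀ x, x - t ∈ twoIntervals α β → x - t' ∈ twoIntervals α β → t = t')
    {t : ℝ} (ht : t ∈ T) : t + 1 ∈ T := by
  rcases eq_or_lt_of_le hα with rfl | hα0
  · obtain ⟨u, hu, ⟨h1, h2⟩ | ⟨h1, h2⟩⟩ := hex (t + 1 + β)
    · linarith
    · rcases eq_or_lt_of_le h1 with h3 | h3
      · rwa [show t + 1 = u by linarith]
      · have := huniq t ht u hu (u + β) (Or.inr ⟨by linarith, by linarith⟩)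
          (Or.inr ⟨by linarith, by linarith⟩)
        linarith
  · have := tiling_sub_gap_mem hα0 hα' hβ hex huniq
      (tiling_add_length_mem hα0 hα' hβ hex huniq ht)
    rwa [show t + (1 + β) - β = t + 1 by ring] at this

lemma tiling_eq_int_translate (hα : 0 ≤ α) (hα' : α < 1 / 2) (hβ : 0 < β)
    (hint : α = 0 ∨ ∃ m : ℤ, β = m)
    (hex : ∀ x, ∃ t ∈ T, x - t ∈ twoIntervals α β)
    (huniq : ∀ t ∈ T, ∀ t' ∈ T, ∀ x, x - t ∈ twoIntervals α β → x - t' ∈ twoIntervals α β → t = t')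
    {t : ℝ} (ht : t ∈ T) : T = range (fun n : ℤ => t + n) := by
  have hadd : ∀ t ∈ T, t + 1 ∈ T := fun t ht => tiling_add_one_mem hα hα' hβ hex huniq ht
  have hsub := sub_mem_of_forall_add_mem hα' hex huniq hadd
  have hsubset : range (fun n : ℤ => t + n) ⊆ T := by
    rintro _ ⟨n, rfl⟩
    induction n using Int.induction_on with
    | zero => simpa using ht
    | succ n ih => have := hadd _ ih; push_cast at this ⊢; rwa [← add_assoc]
    | pred n ih => have := hsub _ ih; push_cast at this ⊢; rwa [← add_sub_assoc]
  refine Subset.antisymm (mem_of_subset_of_cover hα' huniq hsubset fun x => ?_) hsubset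
  -- The integer translates of `t` already cover: modulo 1, `Ω` is a full period, which for `α > 0`
  -- uses that `β` is an integer.
  rcases hint with rfl | ⟨m, hm⟩
  · refine ⟨_, ⟨⌊x - t - β⌋, rfl⟩, Or.inr ⟨?_, ?_⟩⟩
    · linarith [Int.floor_le (x - t - β)]
    · linarith [Int.lt_floor_add_one (x - t - β)]
  · have h1 := Int.floor_le (x - t)
    have h2 := Int.lt_floor_add_one (x - t)
    rcases lt_or_ge (x - t - ⌊x - t⌋) α with h | h
    · exact ⟨_, ⟨⌊x - t⌋, rfl⟩, Or.inl ⟨by linarith, by linarith⟩⟩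
    · refine ⟨_, ⟨⌊x - t⌋ - m, rfl⟩, Or.inr ⟨?_, ?_⟩⟩ <;> push_cast <;> linarith

end TilingByTwoIntervals

/-! ### The set `Ω × [0,1)` tiles along `Λ`, and the columns of `Λ` -/

section Tiling

variable {α β : ℝ} {Λ : Set (ℝ × ℝ)}

lemma disjoint_translates (hα : 0 ≤ α) (hα' : α < 1 / 2) (hβ : 0 < β) (hαβ : α = 0 ∨ 1 - α ≤ β)
    (hΛ : IsGaborOrthonormalBasis (charFn (twoIntervals α β)) Λ) :
    ∀ p ∈ Λ, ∀ q ∈ Λ, ∀ z, z - p ∈ twoIntervals α β ×ˢ Ico (0 : ℝ) 1 →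
      z - q ∈ twoIntervals α β ×ˢ Ico (0 : ℝ) 1 → p = q := by
  rintro p hp q hq z ⟨h1, h2, h3⟩ ⟨h4, h5, h6⟩
  by_contra hpq
  have h0 := ambiguity_eq_zero_of_ne (measurableSet_twoIntervals α β) hΛ hp hq hpq
  simp only [Prod.fst_sub, Prod.snd_sub] at h1 h2 h3 h4 h5 h6
  have hlt : |q.2 - p.2| < 1 := by rw [abs_lt]; constructor <;> linarith
  refine ambiguity_ne_zero hα hα' hβ hαβ hlt.le (Or.inl hlt) ⟨z.1 - p.1, h1, ?_⟩ h0
  change z.1 - p.1 - (q.1 - p.1) ∈ twoIntervals α β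
  rwa [sub_sub_sub_cancel_right]

/-- Intervals closed on the left and open on the right: a point outside stays outside under small
moves up and to the right. A missed point thus yields a missed box of positive area. -/
lemma eventually_box_disjoint {v : ℝ × ℝ} (hv : v ∉ twoIntervals α β ×ˢ Ico (0 : ℝ) 1) :
    ∀ᶠ δ in 𝓝[>] (0 : ℝ), ∀ w : ℝ × ℝ, w ∈ Ico v.1 (v.1 + δ) ×ˢ Ico v.2 (v.2 + δ) →
      w ∉ twoIntervals α β ×ˢ Ico (0 : ℝ) 1 := by
  have hlow : ∀ a x : ℝ, ∀ᶠ δ in 𝓝[>] (0 : ℝ), x < a → x + δ < a := by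
    intro a x
    by_cases h : x < a
    · filter_upwards [Ioo_mem_nhdsGT (sub_pos.2 h)] with δ hδ _
      linarith [hδ.2]
    · exact Filter.Eventually.of_forall fun _ h' => absurd h' h
  filter_upwards [hlow 0 v.1, hlow (α + β) v.1, hlow 0 v.2] with δ d1 d2 d3
  rintro w ⟨⟨w1, w2⟩, w3, w4⟩ ⟨hw, hw1, hw2⟩
  apply hv
  refine ⟨?_, ?_, by linarith⟩
  · rcases hw with ⟨h1, h2⟩ | ⟨h1, h2⟩
    · refine Or.inl ⟨?_, by linarith⟩
      by_contra! h; linarith [d1 h]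
    · refine Or.inr ⟨?_, by linarith⟩
      by_contra! h; linarith [d2 h]
  · by_contra! h; linarith [d3 h]

lemma exists_translate_mem (hα : 0 ≤ α) (hα' : α < 1 / 2) (hβ : 0 < β) (hαβ : α = 0 ∨ 1 - α ≤ β)
    (hΛ : IsGaborOrthonormalBasis (charFn (twoIntervals α β)) Λ) (z : ℝ × ℝ) :
    ∃ p ∈ Λ, z - p ∈ twoIntervals α β ×ˢ Ico (0 : ℝ) 1 := by
  by_contra! hz
  have hS := measurableSet_twoIntervals α β
  have hS1 := volume_twoIntervals hα hα' hβ
  have hSL := twoIntervals_subset hα hα' hβ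
  set E := twoIntervals α β ×ˢ Ico (0 : ℝ) 1 with hE
  have hEm : MeasurableSet E := hS.prod measurableSet_Ico
  have hE1 : volume E = 1 := by
    rw [hE, Measure.volume_eq_prod, Measure.prod_prod, hS1]; simp
  have hEb : Bornology.IsBounded E :=
    ((Metric.isBounded_Ico _ _).subset hSL).prod (Metric.isBounded_Ico _ _)
  have hdisj := disjoint_translates hα hα' hβ hαβ hΛ
  have hbox : Bornology.IsBounded (Ico z.1 (z.1 + 1) ×ˢ Ico z.2 (z.2 + 1)) :=
    (Metric.isBounded_Ico _ _).prod (Metric.isBounded_Ico _ _)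
  -- Only finitely many translates can reach the unit box at `z`, so one `δ` serves all of them.
  have hfin := finite_of_disjoint_translates hEm (by simp [hE1]) hdisj
    (hbox.sub hEb) hEb
  have hev : ∀ᶠ δ in 𝓝[>] (0 : ℝ), ∀ p ∈ Λ ∩ (Ico z.1 (z.1 + 1) ×ˢ Ico z.2 (z.2 + 1) - E),
      ∀ w : ℝ × ℝ, w ∈ Ico (z - p).1 ((z - p).1 + δ) ×ˢ Ico (z - p).2 ((z - p).2 + δ) → w ∉ E :=
    (Filter.eventually_all_finite hfin).2 fun p hp => eventually_box_disjoint (hz p hp.1)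
  obtain ⟨δ, hδ, hδ0, hδ1⟩ := (hev.and (Ioo_mem_nhdsGT (show (0 : ℝ) < 1 / 2 by norm_num))).exists
  set B := Ico z.1 (z.1 + δ) ×ˢ Ico z.2 (z.2 + δ) with hB
  have hBE : ∀ p ∈ Λ, ∀ w ∈ B, w - p ∉ E := by
    rintro p hp w ⟨⟨w1, w2⟩, w3, w4⟩ hw
    refine hδ p ⟨hp, ?_⟩ (w - p) ?_ hw
    · exact ⟨w, ⟨⟨w1, by linarith⟩, w3, by linarith⟩, w - p, hw, by simp⟩
    · simp only [Prod.fst_sub, Prod.snd_sub]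
      exact ⟨⟨by simp only [Prod.fst_sub]; linarith, by simp only [Prod.fst_sub]; linarith⟩,
        by simp only [Prod.snd_sub]; linarith, by simp only [Prod.snd_sub]; linarith⟩
  have hbound := packing_bound hS (by linarith) hSL hS1 hΛ hEm (by simp [hE1]) hdisj hBE z
  rw [hE1] at hbound
  have hzero : ∫⁻ w in B, ‖ambiguity (twoIntervals α β) (z - w)‖ₑ ^ 2 = 0 := by
    have : (∫⁻ w in B, ‖ambiguity (twoIntervals α β) (z - w)‖ₑ ^ 2) + 1 ≤ 0 + 1 := by
      simpa using hbound
    exact nonpos_iff_eq_zero.1 ((ENNReal.add_le_add_iff_right ENNReal.one_ne_top).1 this)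
  refine ((setLIntegral_pos_iff ((measurable_ambiguity hS).comp
    (measurable_const.sub measurable_id))).2 ?_).ne' hzero
  have hsupp : B ⊆ Function.support ((fun p => ‖ambiguity (twoIntervals α β) p‖ₑ ^ 2) ∘
      ((fun _ => z) - id)) := by
    rintro w ⟨⟨w1, w2⟩, w3, w4⟩
    have hlt : |z.2 - w.2| < 1 := by rw [abs_lt]; constructor <;> linarith
    have := ambiguity_ne_zero (τ := z.1 - w.1) hα hα' hβ hαβ hlt.le (Or.inl hlt)
      ⟨α + β, Or.inr ⟨le_rfl, by linarith⟩, Or.inr ⟨by linarith, by linarith⟩⟩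
    simpa [← Prod.mk_sub_mk] using this
  rw [inter_eq_right.2 hsupp, hB, Measure.volume_eq_prod, Measure.prod_prod, Real.volume_Ico,
    Real.volume_Ico]
  simp [hδ0]

/-- The tile covering the point one unit above must start exactly at frequency `ν + 1`, since a
lower one would overlap the tile of `(t, ν)`. Nonvanishing of the ambiguity at frequency 1 for
nonzero time shifts then forces its time to be `t`. -/
lemma add_one_freq_mem (hα : 0 ≤ α) (hα' : α < 1 / 2) (hβ : 0 < β) (hαβ : α = 0 ∨ 1 - α ≤ β)
    (hΛ : IsGaborOrthonormalBasis (charFn (twoIntervals α β)) Λ) {t ν : ℝ} (h : (t, ν) ∈ Λ) :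
    (t, ν + 1) ∈ Λ := by
  obtain ⟨⟨u, η⟩, hp, h1, h2, h3⟩ := exists_translate_mem hα hα' hβ hαβ hΛ (t + (α + β), ν + 1)
  simp only [Prod.fst_sub, Prod.snd_sub] at h1 h2 h3
  have hx : t + (α + β) - t ∈ twoIntervals α β := Or.inr ⟨by linarith, by linarith⟩
  have hη : η = ν + 1 := by
    by_contra hne
    have hlt : η < ν + 1 := lt_of_le_of_ne (by linarith) hne
    have := disjoint_translates hα hα' hβ hαβ hΛ _ h _ hp (t + (α + β), η)
      ⟨hx, by simp only [Prod.snd_sub]; constructor <;> linarith⟩ ⟨h1, by simp⟩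
    have := congrArg Prod.snd this
    simp only at this
    linarith
  subst hη
  have h0 := ambiguity_eq_zero_of_ne (measurableSet_twoIntervals α β) hΛ h hp
    (fun h => by simpa using congrArg Prod.snd h)
  have hut : u - t = 0 := by
    by_contra hne
    refine ambiguity_ne_zero (τ := u - t) (η := 1) hα hα' hβ hαβ (by simp) (Or.inr hne)
      ⟨t + (α + β) - t, hx, ?_⟩ (by simpa using h0)
    change t + (α + β) - t - (u - t) ∈ twoIntervals α β
    rwa [sub_sub_sub_cancel_right]
  rwa [show u = t by linarith] at hp

/-- Raising by 1 the tile that covers the point one unit below gives a tile meeting that of `(t,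
ν)`, hence equal to it. -/
lemma sub_one_freq_mem (hα : 0 ≤ α) (hα' : α < 1 / 2) (hβ : 0 < β) (hαβ : α = 0 ∨ 1 - α ≤ β)
    (hΛ : IsGaborOrthonormalBasis (charFn (twoIntervals α β)) Λ) {t ν : ℝ} (h : (t, ν) ∈ Λ) :
    (t, ν - 1) ∈ Λ := by
  obtain ⟨⟨u, η⟩, hp, h1, h2, h3⟩ := exists_translate_mem hα hα' hβ hαβ hΛ (t + (α + β), ν - 1)
  simp only [Prod.fst_sub, Prod.snd_sub] at h1 h2 h3
  have hx : t + (α + β) - t ∈ twoIntervals α β := Or.inr ⟨by linarith, by linarith⟩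
  have hp1 := add_one_freq_mem hα hα' hβ hαβ hΛ hp
  have := disjoint_translates hα hα' hβ hαβ hΛ _ h _ hp1 (t + (α + β), ν)
    ⟨hx, by simp⟩ ⟨h1, by simp only [Prod.snd_sub]; constructor <;> linarith⟩
  obtain ⟨rfl, rfl⟩ := Prod.mk.inj this
  rwa [add_sub_cancel_right]

lemma add_int_freq_mem (hα : 0 ≤ α) (hα' : α < 1 / 2) (hβ : 0 < β) (hαβ : α = 0 ∨ 1 - α ≤ β)
    (hΛ : IsGaborOrthonormalBasis (charFn (twoIntervals α β)) Λ) {t ν : ℝ} (h : (t, ν) ∈ Λ)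
    (n : ℤ) : (t, ν + n) ∈ Λ := by
  induction n using Int.induction_on with
  | zero => simpa using h
  | succ n ih =>
    have := add_one_freq_mem hα hα' hβ hαβ hΛ ih
    push_cast at this ⊢; rwa [← add_assoc]
  | pred n ih =>
    have := sub_one_freq_mem hα hα' hβ hαβ hΛ ih
    push_cast at this ⊢; rwa [← add_sub_assoc]

/-- Two elements of `Λ` whose time supports meet have the same time coordinate, and their
frequencies differ by an integer. -/
lemma eq_time_of_mem (hα : 0 ≤ α) (hα' : α < 1 / 2) (hβ : 0 < β) (hαβ : α = 0 ∨ 1 - α ≤ β)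
    (hΛ : IsGaborOrthonormalBasis (charFn (twoIntervals α β)) Λ) {t ν t' ν' x : ℝ}
    (h : (t, ν) ∈ Λ) (h' : (t', ν') ∈ Λ) (hx : x - t ∈ twoIntervals α β)
    (hx' : x - t' ∈ twoIntervals α β) : t = t' ∧ ν = ν' + ⌊ν - ν'⌋ := by
  have h1 := Int.floor_le (ν - ν')
  have h2 := Int.lt_floor_add_one (ν - ν')
  have := disjoint_translates hα hα' hβ hαβ hΛ _ h _
    (add_int_freq_mem hα hα' hβ hαβ hΛ h' ⌊ν - ν'⌋) (x, ν) ⟨hx, by simp⟩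
    ⟨hx', by simp only [Prod.snd_sub]; constructor <;> linarith⟩
  exact Prod.mk.inj this

lemma exists_eq_shiftedColumns (hα : 0 ≤ α) (hα' : α < 1 / 2) (hβ : 0 < β)
    (hαβ : α = 0 ∨ 1 - α ≤ β)
    (hΛ : IsGaborOrthonormalBasis (charFn (twoIntervals α β)) Λ) :
    ∃ s ∈ Ico (0 : ℝ) 1, ∃ a : ℤ → ℝ, (∀ k, a k ∈ Ico (0 : ℝ) 1) ∧ Λ = shiftedColumns s a := by
  have hcov := exists_translate_mem hα hα' hβ hαβ hΛ
  obtain ⟨⟨t₀, ν₀⟩, h₀, -⟩ := hcov 0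
  have hint : α = 0 ∨ ∃ m : ℤ, β = m := by
    rcases eq_or_lt_of_le hα with h | h
    · exact Or.inl h.symm
    · right
      have := ambiguity_eq_zero_of_ne (measurableSet_twoIntervals α β) hΛ h₀
        (add_one_freq_mem hα hα' hβ hαβ hΛ h₀) (fun h => by simpa using congrArg Prod.snd h)
      exact exists_int_of_ambiguity_eq_zero h hα' hβ (by simpa using this)
  have hT : Prod.fst '' Λ = range (fun n : ℤ => t₀ + n) := by
    refine tiling_eq_int_translate hα hα' hβ hint ?_ ?_ ⟨_, h₀, rfl⟩
    · intro x
      obtain ⟨p, hp, hx⟩ := hcov (x, 0)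
      exact ⟨p.1, ⟨p, hp, rfl⟩, hx.1⟩
    · rintro _ ⟨⟨t, ν⟩, hp, rfl⟩ _ ⟨⟨t', ν'⟩, hp', rfl⟩ x hx hx'
      exact (eq_time_of_mem hα hα' hβ hαβ hΛ hp hp' hx hx').1
  have hfl : ∀ k : ℤ, t₀ + ((k - ⌊t₀⌋ : ℤ) : ℝ) = k + Int.fract t₀ := by
    intro k; rw [Int.fract]; push_cast; ring
  have hcol : ∀ k : ℤ, ∃ ν : ℝ, ((k : ℝ) + Int.fract t₀, ν) ∈ Λ := by
    intro k
    have : (k : ℝ) + Int.fract t₀ ∈ Prod.fst '' Λ := by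
      rw [hT]
      exact ⟨k - ⌊t₀⌋, hfl k⟩
    obtain ⟨⟨t, ν⟩, hp, ht⟩ := this
    exact ⟨ν, by rw [← ht]; exact hp⟩
  choose ν hν using hcol
  refine ⟨Int.fract t₀, ⟨Int.fract_nonneg _, Int.fract_lt_one _⟩, fun k => Int.fract (ν k),
    fun k => ⟨Int.fract_nonneg _, Int.fract_lt_one _⟩, ?_⟩
  ext ⟨t, η⟩
  simp only [shiftedColumns, mem_iUnion, mem_prod, mem_singleton_iff, mem_range]
  constructor
  · intro hp
    have : t ∈ Prod.fst '' Λ := ⟨_, hp, rfl⟩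
    rw [hT] at this
    obtain ⟨n, hn⟩ := this
    have ht : t = ((n + ⌊t₀⌋ : ℤ) : ℝ) + Int.fract t₀ := by
      rw [← hn, ← hfl]; simp
    refine ⟨n + ⌊t₀⌋, ht, ⌊η - ν (n + ⌊t₀⌋)⌋ + ⌊ν (n + ⌊t₀⌋)⌋, ?_⟩
    have hx : t + (α + β) - t ∈ twoIntervals α β := Or.inr ⟨by linarith, by linarith⟩
    have := (eq_time_of_mem hα hα' hβ hαβ hΛ hp (hν (n + ⌊t₀⌋)) hx (by rwa [← ht])).2
    rw [Int.fract]
    push_cast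
    linarith
  · rintro ⟨k, rfl, n, rfl⟩
    have := add_int_freq_mem hα hα' hβ hαβ hΛ (hν k) (n - ⌊ν k⌋)
    convert this using 2
    rw [Int.fract]; push_cast; ring

end Tiling

/-! ### No basis when the gap is shorter than `1 - α` -/

section Nonexistence

variable {α β : ℝ} {Λ : Set (ℝ × ℝ)}

/-- If two translates of `E` meet and `A` vanishes at their difference, the time shift is `t₀`, so
the common point lies in the trimmed part `[1 - ν₀, ν₀)` of the earlier translate. The frequencies
then differ by less than `ν₀`, so they miss the zero. Hence `E` packs although its area exceeds 1.
-/
lemma false_of_isolated_zero (hα : 0 < α) (hα' : α < 1 / 2) (hβ : 0 < β) {t₀ ν₀ : ℝ}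
    (ht₀ : 0 < t₀) (ht₁ : t₀ ≤ 1 + β) (hν₀ : 1 / 2 ≤ ν₀)
    (hzero : ∀ τ η : ℝ, 0 ≤ τ → τ < 1 + β → |η| < 1 →
      ambiguity (twoIntervals α β) (τ, η) = 0 → τ = t₀ ∧ |η| = ν₀)
    (hν₁ : ν₀ ≤ 1) (harea : 1 < t₀ + (1 + β - t₀) * (2 * ν₀ - 1))
    (hΛ : IsGaborOrthonormalBasis (charFn (twoIntervals α β)) Λ) : False := by
  set E : Set (ℝ × ℝ) := Ico 0 t₀ ×ˢ Ico 0 1 ∪ Ico t₀ (1 + β) ×ˢ Ico (1 - ν₀) ν₀ with hE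
  have hEm : MeasurableSet E := (measurableSet_Ico.prod measurableSet_Ico).union
    (measurableSet_Ico.prod measurableSet_Ico)
  have hvol : 1 < volume E := by
    rw [hE, measure_union _ (measurableSet_Ico.prod measurableSet_Ico), Measure.volume_eq_prod,
      Measure.prod_prod, Measure.prod_prod, Real.volume_Ico, Real.volume_Ico, Real.volume_Ico,
      Real.volume_Ico, ← ENNReal.ofReal_mul (by linarith), ← ENNReal.ofReal_mul (by linarith),
      ← ENNReal.ofReal_add (by linarith) (mul_nonneg (by linarith) (by linarith)),
      ENNReal.one_lt_ofReal]
    · linarith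
    · rw [Set.disjoint_left]
      rintro x ⟨⟨_, h1⟩, _⟩ ⟨⟨h2, _⟩, _⟩
      linarith
  have hbd : ∀ x ∈ E, (0 ≤ x.1 ∧ x.1 < 1 + β) ∧ (0 ≤ x.2 ∧ x.2 < 1) ∧
      (t₀ ≤ x.1 → 1 - ν₀ ≤ x.2 ∧ x.2 < ν₀) := by
    rintro x (⟨⟨h1, h2⟩, h3, h4⟩ | ⟨⟨h1, h2⟩, h3, h4⟩)
    · exact ⟨⟨h1, by linarith⟩, ⟨h3, h4⟩, fun h => by linarith⟩
    · exact ⟨⟨by linarith, h2⟩, ⟨by linarith, by linarith⟩, fun _ => ⟨h3, h4⟩⟩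
  have hle : ∀ p ∈ Λ, ∀ q ∈ Λ, ∀ z, z - p ∈ E → z - q ∈ E → p.1 ≤ q.1 → p = q := by
    intro p hp q hq z h1 h2 hpq1
    by_contra hpq
    have h0 := ambiguity_eq_zero_of_ne (measurableSet_twoIntervals α β) hΛ hp hq hpq
    obtain ⟨⟨a1, a2⟩, ⟨a3, a4⟩, a5⟩ := hbd _ h1
    obtain ⟨⟨b1, b2⟩, ⟨b3, b4⟩, b5⟩ := hbd _ h2
    simp only [Prod.fst_sub, Prod.snd_sub] at a1 a2 a3 a4 a5 b1 b2 b3 b4 b5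
    obtain ⟨e1, e2⟩ := hzero (q.1 - p.1) (q.2 - p.2) (by linarith) (by linarith)
      (by rw [abs_lt]; constructor <;> linarith) h0
    obtain ⟨c1, c2⟩ := a5 (by linarith)
    rcases abs_cases (q.2 - p.2) with ⟨h, _⟩ | ⟨h, _⟩ <;> linarith
  have hdisj : ∀ p ∈ Λ, ∀ q ∈ Λ, ∀ z, z - p ∈ E → z - q ∈ E → p = q := by
    intro p hp q hq z h1 h2
    rcases le_total p.1 q.1 with h | h
    · exact hle p hp q hq z h1 h2 h
    · exact (hle q hq p hp z h2 h1 h).symm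
  have hbound := packing_bound (measurableSet_twoIntervals α β) (by linarith)
    (twoIntervals_subset hα.le hα' hβ) (volume_twoIntervals hα.le hα' hβ) hΛ hEm
    (fun h => by simp [h] at hvol) hdisj (B := ∅) (by simp) 0
  simp only [Measure.restrict_empty, lintegral_zero_measure, zero_add] at hbound
  exact absurd hbound (not_le.2 hvol)

lemma not_isGaborOrthonormalBasis (hα : 0 < α) (hα' : α < 1 / 2) (hβ : 0 < β) (hαβ : β < 1 - α) :
    ¬ IsGaborOrthonormalBasis (charFn (twoIntervals α β)) Λ := by
  intro hΛ
  have hlarge : ∀ {x u : ℝ}, u ≤ 1 → x < 1 → 0 ≤ x → x * u ≠ 1 := by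
    intro x u h1 h2 h3 h
    nlinarith
  rcases le_or_gt (1 - 3 * α) β with hc | hc
  · have hz := fun τ η h1 h2 h3 h4 =>
      (zeros_of_ambiguity (τ := τ) (η := η) hα hα' hβ hαβ h1 h2 h3 h4).resolve_right
        (fun h => by linarith [h.1])
    rcases le_or_gt (1 - α + β) 1 with hu | hu
    -- The candidate zero has `|η| ≥ 1`, outside the strip. With `ν₀ = 1` nothing is trimmed, and
    -- the area is `1 + β`.
    · refine false_of_isolated_zero hα hα' hβ (t₀ := (1 - α + β) / 2) (ν₀ := 1) (by linarith)
        (by linarith) (by norm_num) (fun τ η h1 h2 h3 h4 => ?_) le_rfl (by linarith) hΛ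
      exact absurd (hz τ η h1 h2 h3 h4).2.2 (hlarge hu h3 (abs_nonneg _))
    · have hu0 : 0 < 1 - α + β := by linarith
      refine false_of_isolated_zero hα hα' hβ (t₀ := (1 - α + β) / 2) (ν₀ := 1 / (1 - α + β))
        (by linarith) (by linarith) (one_div_le_one_div_of_le hu0 (by linarith))
        (fun τ η h1 h2 h3 h4 => ?_) ?_ ?_ hΛ
      · obtain ⟨-, h5, h6⟩ := hz τ η h1 h2 h3 h4
        exact ⟨h5, eq_div_of_mul_eq hu0.ne' h6⟩
      · rw [div_le_one hu0]; exact hu.le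
      · rw [show (1 - α + β) / 2 + (1 + β - (1 - α + β) / 2) * (2 * (1 / (1 - α + β)) - 1) =
          ((1 - α + β) ^ 2 / 2 + (1 + β - (1 - α + β) / 2) * (2 - (1 - α + β))) / (1 - α + β) by
          field_simp, lt_div_iff₀ hu0]
        -- With `u = 1 - α + β`, the numerator exceeds `u` by exactly `α (2 - u)`.
        nlinarith [mul_pos (show 0 < 2 - (1 - α + β) by linarith) hα]
  · have hz := fun τ η h1 h2 h3 h4 =>
      (zeros_of_ambiguity (τ := τ) (η := η) hα hα' hβ hαβ h1 h2 h3 h4).resolve_left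
        (fun h => by linarith [h.1])
    rcases le_or_gt (2 * (α + β)) 1 with hu | hu
    · refine false_of_isolated_zero hα hα' hβ (t₀ := 1 - 2 * α) (ν₀ := 1) (by linarith)
        (by linarith) (by norm_num) (fun τ η h1 h2 h3 h4 => ?_) le_rfl (by linarith) hΛ
      exact absurd (hz τ η h1 h2 h3 h4).2.2 (hlarge hu h3 (abs_nonneg _))
    · have hu0 : 0 < 2 * (α + β) := by linarith
      refine false_of_isolated_zero hα hα' hβ (t₀ := 1 - 2 * α) (ν₀ := 1 / (2 * (α + β)))
        (by linarith) (by linarith) (one_div_le_one_div_of_le hu0 (by linarith))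
        (fun τ η h1 h2 h3 h4 => ?_) ?_ ?_ hΛ
      · obtain ⟨-, h5, h6⟩ := hz τ η h1 h2 h3 h4
        exact ⟨h5, eq_div_of_mul_eq hu0.ne' h6⟩
      · rw [div_le_one hu0]; exact hu.le
      · have key : 2 * α < (β + 2 * α) * (2 - 2 * (α + β)) / (2 * (α + β)) := by
          rw [lt_div_iff₀ hu0]
          nlinarith [mul_pos (show 0 < 2 * (α + β) - 1 by linarith)
            (show 0 < 1 - 3 * α - β by linarith), mul_pos hα hα, mul_pos hα hβ]
        have e : 1 - 2 * α + (1 + β - (1 - 2 * α)) * (2 * (1 / (2 * (α + β))) - 1) =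
            1 - 2 * α + (β + 2 * α) * (2 - 2 * (α + β)) / (2 * (α + β)) := by
          have : α + β ≠ 0 := by linarith
          field_simp
          ring
        rw [e]
        linarith

end Nonexistence

end

theorem mainTheorem3 (α β : ℝ) (hα : 0 ≤ α) (hα' : α < 1 / 2) (hβ : 0 < β)
    (Λ : Set (ℝ × ℝ))
    (hΛ : IsGaborOrthonormalBasis (charFn (twoIntervals α β)) Λ) :
    (((0 : ℝ), (0 : ℝ)) ∈ Λ → IsStandard Λ) ∧
    ∃ s ∈ Ico (0 : ℝ) 1, ∃ a : ℤ → ℝ, (∀ k, a k ∈ Ico (0 : ℝ) 1) ∧ Λ = shiftedColumns s a := by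
  have hαβ : α = 0 ∨ 1 - α ≤ β := by
    by_contra! h
    exact not_isGaborOrthonormalBasis (lt_of_le_of_ne hα (Ne.symm h.1)) hα' hβ h.2 hΛ
  have hmain := exists_eq_shiftedColumns hα hα' hβ hαβ hΛ
  refine ⟨fun h0 => ?_, hmain⟩
  obtain ⟨s, hs, a, ha, rfl⟩ := hmain
  -- The origin lies in some column `k + s = 0`, and `s ∈ [0, 1)` leaves only `k = 0`.
  have hs0 : s = 0 := by
    simp only [shiftedColumns, mem_iUnion, mem_prod, mem_singleton_iff] at h0
    obtain ⟨k, hk, -⟩ := h0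
    have h1 : (-1 : ℝ) < k := by linarith [hs.2]
    have h2 : (k : ℝ) < 1 := by linarith [hs.1]
    have h1' : -1 < k := by exact_mod_cast h1
    have h2' : k < 1 := by exact_mod_cast h2
    obtain rfl : k = 0 := by omega
    simpa using hk.symm
  refine ⟨a, ha, ?_⟩
  simp [shiftedColumns, hs0]
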